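/- Let $n\ge 1$. A permutation $\sigma\in\mathfrak S_n$ is drawn as a diagram with $n$ points on a bottom line and $n$ points on a top line, numbered from left to right, and the edges $(i^-,\sigma(i)^+)$. It is irreducible if $\{\sigma(1),\dots,\sigma(k)\}\ne\{n-k+1,\dots,n\}$ for all $1\le k<n$. On irreducible permutations consider two operators. $L$ moves each top endpoint at the right of $\sigma(1)$ one step to the right, the last one moving to position $\sigma(1)+1$. $R$ moves each bottom endpoint at the left of $p=\sigma^{-1}(n)$ one step to the left, the first one moving to position $p-1$. A class $C$ is a connected component of the graph on irreducible permutations of size $n$ with edges $\sigma - L\sigma$ and $\sigma - R\sigma$. Cycle invariant. Replace each diagram point $i^\pm$ by a black endpoint $i_b^\pm$ and, at its right, a white endpoint $i_w^\pm$. For each $i$, with $j=\sigma(i)$, draw the edges $(i_b^-,j_w^+)$ and $(i_w^-,j_b^+)$. Connect $i_w^\pm$ to $(i+1)_b^\pm$ by an arc for $1\le i\le n-1$, on the bottom and on the top, and connect $n_w^+$ to $1_b^-$. The result consists of one open path, joining $1_b^+$ to $n_w^-$, and of closed cycles. The length of a path or cycle is its number of top arcs. The rank $r$ is the length of the open path,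 $\ell$ is the number of closed cycles, and $\lambda=\{\lambda_1,\dots,\lambda_\ell\}$ is the multiset of their lengths. Sign. Let $\bar A(\sigma)=\sum_{I\subseteq[n]}(-1)^{|I|+\chi(I)}$, where $\chi(I)$ is the number of pairs $i<j$ in $I$ with $\sigma(i)<\sigma(j)$, and let $s=\mathrm{Sign}(\bar A(\sigma))\in\{-1,0,1\}$. Statement. Let $C$ be a class of irreducible permutations of size $n$, and let $(\lambda,r,s)$, $\ell$ and $\bar A$ be computed from any element $\sigma\in C$. Then: 1. the list $\{r,\lambda_1,\dots,\lambda_\ell\}$ has an even number of even entries; 2. $s=2^{-\frac{n+\ell}{2}}\,\bar A(\sigma)$; 3. $s=0$ if and only if at least one of the entries $r,\lambda_1,\dots,\lambda_\ell$ is even. -/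

import Mathlib

namespace RauzyDyn

/-! Permutations of size `n` are elements of `Equiv.Perm (Fin n)`; positions and values are
numbered from `0` to `n - 1`, from left to right. In the diagram of `σ`, the edge `i` joins the
`i`-th bottom point to the `σ i`-th top point. -/

/-- `σ` is irreducible if it maps no set formed by the first `k` positions, `1 ≤ k < n`, onto the
set formed by the last `k` values. -/
def Irred {n : ℕ} (σ : Equiv.Perm (Fin n)) : Prop :=
  ∀ k : ℕ, 0 < k → k < n → σ '' {i | i.val < k} ≠ {j | n - k ≤ j.val}

/-- The rotation of the points at the right of `a`: each of them moves one step to the right,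
and the last one becomes the first point after `a`. -/
def shiftAboveFun {n : ℕ} (a v : Fin n) : Fin n :=
  if h : v ≤ a then v
  else if h' : v.val + 1 < n then ⟨v.val + 1, h'⟩
  else ⟨a.val + 1, by omega⟩

theorem shiftAboveFun_injective {n : ℕ} (a : Fin n) :
    Function.Injective (shiftAboveFun a) := by
  intro v w h
  unfold shiftAboveFun at h
  split_ifs at h <;> simp only [Fin.ext_iff, Fin.le_def] at * <;> omega

/-- `shiftAboveFun a` as a permutation. -/
noncomputable def shiftAbove {n : ℕ} (a : Fin n) : Equiv.Perm (Fin n) :=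
  Equiv.ofBijective (shiftAboveFun a)
    (Finite.injective_iff_bijective.1 (shiftAboveFun_injective a))

/-- The rotation of the points at the left of `p`, in the form position `↦` the point whose
content arrives there when each of these points moves one step to the left, the first one moving
to the place just before `p`. -/
def pullBelowFun {n : ℕ} (p i : Fin n) : Fin n :=
  if h : p ≤ i then i
  else if h' : i.val + 1 < p.val then ⟨i.val + 1, by omega⟩
  else ⟨0, by omega⟩

theorem pullBelowFun_injective {n : ℕ} (p : Fin n) :
    Function.Injective (pullBelowFun p) := by
  intro v w h
  unfold pullBelowFun at h
  split_ifs at h <;> simp only [Fin.ext_iff, Fin.le_def] at * <;> omega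

/-- `pullBelowFun p` as a permutation. -/
noncomputable def pullBelow {n : ℕ} (p : Fin n) : Equiv.Perm (Fin n) :=
  Equiv.ofBijective (pullBelowFun p)
    (Finite.injective_iff_bijective.1 (pullBelowFun_injective p))

/-- The operator `L`: with the edge at the first bottom point as pivot, rotate the top endpoints
at the right of the top endpoint of the pivot. -/
noncomputable def opL {n : ℕ} [NeZero n] (σ : Equiv.Perm (Fin n)) : Equiv.Perm (Fin n) :=
  shiftAbove (σ 0) * σ

/-- The operator `R`: with the edge at the last top point as pivot, rotate the bottom endpoints
at the left of the bottom endpoint of the pivot. -/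
noncomputable def opR {n : ℕ} [NeZero n] (σ : Equiv.Perm (Fin n)) : Equiv.Perm (Fin n) :=
  σ * pullBelow (σ.symm (Fin.rev 0))

theorem perm_image_eq_of_subset {n : ℕ} (g : Equiv.Perm (Fin n)) (S : Set (Fin n))
    (h : ∀ x ∈ S, g x ∈ S) : g '' S = S := by
  apply Set.eq_of_subset_of_ncard_le
  · rintro _ ⟨x, hx, rfl⟩
    exact h x hx
  · rw [Set.ncard_image_of_injective _ g.injective]
  · exact S.toFinite

theorem opL_irred {n : ℕ} [NeZero n] {σ : Equiv.Perm (Fin n)} (hσ : Irred σ) :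
    Irred (opL σ) := by
  intro k hk hkn h
  have ha : (σ 0) ∈ {j : Fin n | n - k ≤ j.val} := by
    rw [← h]
    refine ⟨0, by simpa using hk, ?_⟩
    simp [opL, shiftAbove, shiftAboveFun]
  have hS : shiftAbove (σ 0) '' {j : Fin n | n - k ≤ j.val} = {j : Fin n | n - k ≤ j.val} := by
    apply perm_image_eq_of_subset
    intro x hx
    simp only [Set.mem_ofPred_eq] at hx ha ⊢
    simp only [shiftAbove, Equiv.ofBijective_apply, shiftAboveFun]
    split_ifs <;> first | omega | (simp only []; omega)
  apply hσ k hk hkn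
  apply Set.image_injective.2 (shiftAbove (σ 0)).injective
  rw [hS, ← h, ← Set.image_comp]
  rfl

theorem opR_irred {n : ℕ} [NeZero n] {σ : Equiv.Perm (Fin n)} (hσ : Irred σ) :
    Irred (opR σ) := by
  intro k hk hkn h
  have hlast : (Fin.rev 0 : Fin n) ∈ {j : Fin n | n - k ≤ j.val} := by
    simp only [Set.mem_ofPred_eq, Fin.val_rev]
    simp
    omega
  rw [← h] at hlast
  obtain ⟨i, hi, hi'⟩ := hlast
  have hp : i = σ.symm (Fin.rev 0) := by
    apply (opR σ).injective
    rw [hi']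
    simp [opR, pullBelow, pullBelowFun]
  have hA : pullBelow (σ.symm (Fin.rev 0)) '' {i : Fin n | i.val < k} =
      {i : Fin n | i.val < k} := by
    apply perm_image_eq_of_subset
    intro x hx
    rw [hp] at hi
    simp only [Set.mem_ofPred_eq] at hx hi ⊢
    simp only [pullBelow, Equiv.ofBijective_apply, pullBelowFun]
    split_ifs <;> first | omega | (simp only []; omega)
  apply hσ k hk hkn
  rw [← h]
  conv_lhs => rw [← hA]
  rw [← Set.image_comp]
  rfl

/-- The space of configurations: irreducible permutations of size `n`. -/
abbrev IrredPerm (n : ℕ) : Type := {σ : Equiv.Perm (Fin n) // Irred σ}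

/-- The operator `L` on irreducible permutations. -/
noncomputable def L {n : ℕ} [NeZero n] (σ : IrredPerm n) : IrredPerm n :=
  ⟨opL σ.1, opL_irred σ.2⟩

/-- The operator `R` on irreducible permutations. -/
noncomputable def R {n : ℕ} [NeZero n] (σ : IrredPerm n) : IrredPerm n :=
  ⟨opR σ.1, opR_irred σ.2⟩

/-- The class of `σ`: all configurations connected to `σ` in the Cayley graph of the dynamics
generated by `L` and `R`. -/
def rauzyClass {n : ℕ} [NeZero n] (σ : IrredPerm n) : Set (IrredPerm n) :=
  {τ | Relation.EqvGen (fun x y => y = L x ∨ y = R x) σ τ}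

/-- The set `C` is a class of the dynamics. -/
def IsRauzyClass {n : ℕ} [NeZero n] (C : Set (IrredPerm n)) : Prop :=
  ∃ σ : IrredPerm n, C = rauzyClass σ

/-- The endpoints of the doubled diagram: `bb i`, `bw i` are the black and the white endpoint
at the `i`-th bottom point, `tb i`, `tw i` those at the `i`-th top point. -/
inductive Endpoint (n : ℕ) : Type
  | bb (i : Fin n)
  | bw (i : Fin n)
  | tb (i : Fin n)
  | tw (i : Fin n)

/-- The elementary connections of the doubled diagram: two crossing edges for each edge of `σ`,
the arcs from each white endpoint to the black endpoint at its right on the same side, and the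
mark, which joins the top-right endpoint to the bottom-left one. -/
inductive Link {n : ℕ} (σ : Equiv.Perm (Fin n)) : Endpoint n → Endpoint n → Prop
  | edge_bw (i : Fin n) : Link σ (.bb i) (.tw (σ i))
  | edge_wb (i : Fin n) : Link σ (.bw i) (.tb (σ i))
  | arc_bot (i j : Fin n) (h : j.val = i.val + 1) : Link σ (.bw i) (.bb j)
  | arc_top (i j : Fin n) (h : j.val = i.val + 1) : Link σ (.tw i) (.tb j)
  | mark (i j : Fin n) (hi : i.val + 1 = n) (hj : j.val = 0) : Link σ (.tw i) (.bb j)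

/-- The graph formed by all these connections. Its connected components are one open path, from
the top-left endpoint to the bottom-right one, and a number of closed cycles. -/
def diagramGraph {n : ℕ} (σ : Equiv.Perm (Fin n)) : SimpleGraph (Endpoint n) :=
  SimpleGraph.fromRel (Link σ)

/-- The cycles and the open path. -/
abbrev Comp {n : ℕ} (σ : Equiv.Perm (Fin n)) : Type :=
  (diagramGraph σ).ConnectedComponent

/-- The rank path: the component of the top-left endpoint. -/
def rankPath {n : ℕ} [NeZero n] (σ : Equiv.Perm (Fin n)) : Comp σ :=
  (diagramGraph σ).connectedComponentMk (.tb 0)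

/-- The length of a cycle or path: the number of its top arcs. There is a top arc starting at the
white endpoint `i` for each `i` but the last one. -/
noncomputable def compLength {n : ℕ} (σ : Equiv.Perm (Fin n)) (c : Comp σ) : ℕ :=
  {i : Fin n | i.val + 1 < n ∧ (diagramGraph σ).connectedComponentMk (.tw i) = c}.ncard

instance {n : ℕ} : Finite (Endpoint n) :=
  Finite.of_injective
    (fun x : Endpoint n => match x with
      | .bb i => (Sum.inl (Sum.inl i) : (Fin n ⊕ Fin n) ⊕ (Fin n ⊕ Fin n))
      | .bw i => Sum.inl (Sum.inr i)
      | .tb i => Sum.inr (Sum.inl i)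
      | .tw i => Sum.inr (Sum.inr i))
    (by rintro (i | i | i | i) (j | j | j | j) h <;> simp_all)

instance {n : ℕ} (σ : Equiv.Perm (Fin n)) : Finite (Comp σ) :=
  Quot.finite _

/-- The rank `r`: the length of the rank path. -/
noncomputable def rank {n : ℕ} [NeZero n] (σ : Equiv.Perm (Fin n)) : ℕ :=
  compLength σ (rankPath σ)

open scoped Classical in
/-- The cycle structure `λ`: the multiset of the lengths of the cycles (the rank path is not
counted). -/
noncomputable def cycleStructure {n : ℕ} [NeZero n] (σ : Equiv.Perm (Fin n)) : Multiset ℕ :=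
  ((Set.toFinite {c : Comp σ | c ≠ rankPath σ}).toFinset).val.map (compLength σ)

/-- The number `ℓ` of cycles, not counting the rank path. -/
noncomputable def numCycles {n : ℕ} [NeZero n] (σ : Equiv.Perm (Fin n)) : ℕ :=
  Set.ncard {c : Comp σ | c ≠ rankPath σ}

/-- The number of pairs of non-crossing edges in a set `I` of edges. -/
def chi {n : ℕ} (σ : Equiv.Perm (Fin n)) (I : Finset (Fin n)) : ℕ :=
  ((I ×ˢ I).filter (fun p => p.1 < p.2 ∧ σ p.1 < σ p.2)).card

/-- The Arf function `Ā`. -/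
def arfBar {n : ℕ} (σ : Equiv.Perm (Fin n)) : ℤ :=
  ∑ I : Finset (Fin n), (-1) ^ (I.card + chi σ I)

/-- The sign `s`, an element of `{-1, 0, 1}`. -/
def sgn {n : ℕ} (σ : Equiv.Perm (Fin n)) : ℤ :=
  Int.sign (arfBar σ)

end RauzyDyn

/-! Identify subsets `I` with vectors over `ZMod 2`. Then `Ā` is the Gauss sum of `(-1)^q` for the
quadratic form `q = |I| + χ(I)`, and its square is `2^n` times the size of the radical of the polar
form if `q` vanishes on that radical, and `0` otherwise (`sq_sum_zsgn`).

The radical can be read off the diagram: its vectors are the jumps, across the edges, of functions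
on the components that vanish on the open path. So it has `2^ℓ` elements (`card_ker_polarForm`) and
is spanned by one vector per closed cycle. On the vector of a cycle of length `m`, `q` equals `m +
1` (`quadForm_cycleVec`), because the sign of a cyclic permutation of gaps can also be computed by
counting non-crossing pairs. Hence `Ā²` is `2^(n+ℓ)` if all closed cycles are odd, and `0`
otherwise.

Subtracting a linear form makes `q` vanish on the radical, so `2^(n+ℓ)` is always a square and `n +
ℓ` is even (`even_add_numCycles`). The `ℓ + 1` lengths add up to `n - 1`, so the number of even ones
has the parity of `n + ℓ`. In particular the open path is never the only even entry, and the
condition on closed cycles is one on the whole list. -/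

namespace RauzyDyn

/-! ### Gauss sums of quadratic forms over `ZMod 2` -/

open Finset

/-- The nontrivial character of `ZMod 2`. -/
def zsgn (a : ZMod 2) : ℤ := if a = 0 then 1 else -1

theorem zsgn_zero : zsgn 0 = 1 := rfl

theorem zsgn_one : zsgn 1 = -1 := rfl

theorem zsgn_add (a b : ZMod 2) : zsgn (a + b) = zsgn a * zsgn b := by
  revert a b; decide

theorem zsgn_natCast (k : ℕ) : zsgn k = (-1) ^ k := by
  induction k with
  | zero => rfl
  | succ k ih => rw [Nat.cast_succ, zsgn_add, ih, zsgn_one, pow_succ]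

theorem zsgn_sum {ι : Type*} (s : Finset ι) (a : ι → ZMod 2) :
    zsgn (∑ i ∈ s, a i) = ∏ i ∈ s, zsgn (a i) := by
  classical
  induction s using Finset.induction_on with
  | empty => rfl
  | insert i s hi ih => rw [sum_insert hi, prod_insert hi, zsgn_add, ih]

theorem zsgn_injective : Function.Injective zsgn := by decide

-- Translation by an element where `φ` is nonzero negates the sum.
open scoped Classical in
theorem sum_zsgn_of_additive {G : Type*} [AddCommGroup G] [Fintype G] (φ : G → ZMod 2)
    (hφ : ∀ x y, φ (x + y) = φ x + φ y) :
    ∑ x, zsgn (φ x) = if ∀ x, φ x = 0 then (Fintype.card G : ℤ) else 0 := by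
  split_ifs with h
  · simp [h, zsgn_zero]
  · push Not at h
    obtain ⟨a, ha⟩ := h
    have h1 : ∑ x, zsgn (φ (a + x)) = ∑ x, zsgn (φ x) :=
      Fintype.sum_equiv (Equiv.addLeft a) _ _ fun _ => rfl
    have h2 : zsgn (φ a) = -1 := if_neg ha
    simp only [hφ, zsgn_add, ← mul_sum, h2] at h1
    linarith

section GaussSum

variable {V : Type*} [AddCommGroup V] [Module (ZMod 2) V] [Fintype V]
  (q : V → ZMod 2) (B : V →ₗ[ZMod 2] V →ₗ[ZMod 2] ZMod 2)

-- In the double sum, replacing the first variable by `x + y` leaves the exponent `q x + B x y`. The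
-- sum over `y` kills every `x` outside the radical, and on the radical `q` is additive.
open scoped Classical in
theorem sq_sum_zsgn (h : ∀ x y, q (x + y) = q x + q y + B x y) :
    (∑ x, zsgn (q x)) ^ 2 =
      if ∀ x, B x = 0 → q x = 0 then (Fintype.card V * Nat.card (LinearMap.ker B) : ℤ) else 0 := by
  have e1 : (∑ x, zsgn (q x)) ^ 2 = ∑ x, zsgn (q x) * ∑ y, zsgn (B x y) := by
    rw [sq, sum_mul_sum, sum_comm]
    simp only [mul_sum]
    rw [sum_comm (γ := V) (f := fun x i => zsgn (q x) * zsgn (B x i))]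
    refine sum_congr rfl fun y _ => ?_
    refine (Fintype.sum_equiv (Equiv.addRight y) _ _ fun x => ?_).symm
    rw [Equiv.coe_addRight, ← zsgn_add, ← zsgn_add, h]
    congr 1
    linear_combination (-1 : ZMod 2) * CharTwo.add_self_eq_zero (q y)
  have e2 : ∀ x, ∑ y, zsgn (B x y) = if B x = 0 then (Fintype.card V : ℤ) else 0 := by
    intro x
    rw [sum_zsgn_of_additive (B x) (map_add (B x))]
    simp only [LinearMap.ext_iff, LinearMap.zero_apply]
  have e3 : ∑ x : LinearMap.ker B, zsgn (q x) =
      if ∀ x, B x = 0 → q x = 0 then (Nat.card (LinearMap.ker B) : ℤ) else 0 := by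
    rw [sum_zsgn_of_additive (fun x : LinearMap.ker B => q x), Nat.card_eq_fintype_card]
    · simp only [Subtype.forall, LinearMap.mem_ker]
    · intro x y
      have hx : B (x : V) = 0 := x.2
      simp [h, hx]
  have e4 : ∑ x : LinearMap.ker B, zsgn (q x) = ∑ x, if B x = 0 then zsgn (q x) else 0 := by
    rw [← sum_filter]
    refine (sum_subtype _ ?_ (fun x => zsgn (q x))).symm
    simp
  rw [e1]
  simp only [e2, mul_ite, mul_zero]
  have e5 : ∑ x, (if B x = 0 then zsgn (q x) * (Fintype.card V : ℤ) else 0) =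
      Fintype.card V * ∑ x, if B x = 0 then zsgn (q x) else 0 := by
    rw [mul_sum]
    refine sum_congr rfl fun x _ => ?_
    split_ifs <;> ring
  rw [e5, ← e4, e3]
  split_ifs <;> simp

/-- The restriction of `q` to the radical extends to a linear form, and subtracting it leaves a
quadratic form with the same polar form that vanishes on the radical. -/
theorem isSquare_card_mul_card_ker (h : ∀ x y, q (x + y) = q x + q y + B x y) :
    IsSquare (Fintype.card V * Nat.card (LinearMap.ker B) : ℤ) := by
  let φ : LinearMap.ker B →+ ZMod 2 := AddMonoidHom.mk' (fun x => q x) fun x y => by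
    have hx : B (x : V) = 0 := x.2
    simp [h, hx]
  obtain ⟨g, hg⟩ := LinearMap.exists_extend (AddMonoidHom.toZModLinearMap 2 φ)
  have hg' : ∀ x, B x = 0 → g x = q x := fun x hx =>
    congrArg (fun l => l ⟨x, hx⟩) hg
  refine ⟨∑ x, zsgn (q x + g x), ?_⟩
  rw [← sq, sq_sum_zsgn (fun x => q x + g x) B, if_pos]
  · intro x hx
    rw [hg' x hx, CharTwo.add_self_eq_zero]
  · intro x y
    simp only [h, map_add]
    ring

end GaussSum

end RauzyDyn

/-! ### Components of the diagram as cycles of a permutation of the gaps -/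

namespace RauzyDyn

open Finset

section Gaps

variable {n : ℕ} (σ : Equiv.Perm (Fin n))

/-- The gaps of either line are numbered from `0` to `n`. This is the top gap reached from a
bottom gap by the strand on the left of an edge; the last bottom gap is sent to the first top
gap. -/
def strandUp : Equiv.Perm (Fin (n + 1)) :=
  finSuccEquivLast.trans ((Equiv.optionCongr σ).trans (finSuccEquiv n).symm)

/-- The top gap reached from a bottom gap by the strand on the right of an edge; the first bottom
gap is sent by the mark to the last top gap. -/
def strandDown : Equiv.Perm (Fin (n + 1)) :=
  (finSuccEquiv n).trans ((Equiv.optionCongr σ).trans finSuccEquivLast.symm)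

@[simp] theorem strandUp_castSucc (i : Fin n) : strandUp σ i.castSucc = (σ i).succ := by
  simp [strandUp]

@[simp] theorem strandUp_last : strandUp σ (Fin.last n) = 0 := by
  simp [strandUp]

@[simp] theorem strandDown_succ (i : Fin n) : strandDown σ i.succ = (σ i).castSucc := by
  simp [strandDown]

@[simp] theorem strandDown_zero : strandDown σ 0 = Fin.last n := by
  simp [strandDown]

/-- The permutation of the bottom gaps that follows a cycle up an edge and down the next one. -/
def gapPerm : Equiv.Perm (Fin (n + 1)) := (strandDown σ)⁻¹ * strandUp σ

theorem strandDown_gapPerm (g : Fin (n + 1)) : strandDown σ (gapPerm σ g) = strandUp σ g := by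
  simp [gapPerm]

theorem strandDown_symm_castSucc (i : Fin n) :
    (strandDown σ).symm (σ i).castSucc = i.succ := by
  rw [Equiv.symm_apply_eq, strandDown_succ]

theorem strandDown_symm_last : (strandDown σ).symm (Fin.last n) = 0 := by
  rw [Equiv.symm_apply_eq, strandDown_zero]

theorem gapPerm_apply (g : Fin (n + 1)) :
    gapPerm σ g = (strandDown σ).symm (strandUp σ g) := rfl

theorem mk_eq_of_link {a b : Endpoint n} (h : Link σ a b) :
    (diagramGraph σ).connectedComponentMk a = (diagramGraph σ).connectedComponentMk b := by
  by_cases hab : a = b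
  · rw [hab]
  · refine SimpleGraph.ConnectedComponent.sound (SimpleGraph.Adj.reachable ?_)
    exact (SimpleGraph.fromRel_adj _ _ _).2 ⟨hab, Or.inl h⟩

theorem apply_eq_of_mk_eq {A : Sort*} (f : Endpoint n → A)
    (hf : ∀ a b, Link σ a b → f a = f b) {a b : Endpoint n}
    (h : (diagramGraph σ).connectedComponentMk a = (diagramGraph σ).connectedComponentMk b) :
    f a = f b := by
  obtain ⟨w⟩ := SimpleGraph.ConnectedComponent.exact h
  induction w with
  | nil => rfl
  | cons hadj _ ih =>
    rw [← ih (SimpleGraph.ConnectedComponent.sound ⟨by assumption⟩)]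
    rcases ((SimpleGraph.fromRel_adj _ _ _).1 hadj).2 with h | h
    · exact hf _ _ h
    · exact (hf _ _ h).symm

/-- The bottom gap at which an endpoint lies, or from which the strand to its top gap descends. -/
def Endpoint.gap : Endpoint n → Fin (n + 1)
  | .bb i => i.castSucc
  | .bw i => i.succ
  | .tb k => (strandDown σ).symm k.castSucc
  | .tw k => (strandDown σ).symm k.succ

/-- Every link keeps the gap except `edge_bw`, which advances it by one step of `gapPerm`. -/
theorem sameCycle_gap_of_link {a b : Endpoint n} (h : Link σ a b) :
    (gapPerm σ).SameCycle (a.gap σ) (b.gap σ) := by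
  cases h with
  | edge_bw i =>
    have : Endpoint.gap σ (.tw (σ i)) = gapPerm σ i.castSucc := by
      rw [gapPerm_apply, strandUp_castSucc]; rfl
    rw [this]
    exact Equiv.Perm.sameCycle_apply_right.2 (Equiv.Perm.SameCycle.refl _ _)
  | edge_wb i =>
    have : Endpoint.gap σ (.tb (σ i)) = i.succ := strandDown_symm_castSucc σ i
    rw [this]
    exact Equiv.Perm.SameCycle.refl _ _
  | arc_bot i j h =>
    have : i.succ = j.castSucc := by ext; simp [h]
    simp only [Endpoint.gap, this]
    exact Equiv.Perm.SameCycle.refl _ _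
  | arc_top i j h =>
    have : i.succ = j.castSucc := by ext; simp [h]
    simp only [Endpoint.gap, this]
    exact Equiv.Perm.SameCycle.refl _ _
  | mark i j hi hj =>
    have h1 : i.succ = Fin.last n := by ext; simp [hi]
    have h2 : j.castSucc = 0 := by ext; simp [hj]
    simp only [Endpoint.gap, h1, h2, strandDown_symm_last]
    exact Equiv.Perm.SameCycle.refl _ _

theorem sameCycle_gap_of_mk_eq {a b : Endpoint n}
    (h : (diagramGraph σ).connectedComponentMk a = (diagramGraph σ).connectedComponentMk b) :
    (gapPerm σ).SameCycle (a.gap σ) (b.gap σ) := by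
  have := apply_eq_of_mk_eq σ (fun e => (gapPerm σ).SameCycle (a.gap σ) (e.gap σ))
    (fun x y hxy => propext
      ⟨fun hx => hx.trans (sameCycle_gap_of_link σ hxy),
        fun hy => hy.trans (sameCycle_gap_of_link σ hxy).symm⟩) h
  rw [← this]

open scoped Classical in
noncomputable instance : Fintype (Comp σ) := Fintype.ofFinite _

theorem sum_compLength : ∑ c, compLength σ c = n - 1 := by
  classical
  have h1 : #{i : Fin n | i.val + 1 < n} = n - 1 := by
    have h2 : ∀ i : Fin n, i.val + 1 < n ↔ i.val < n - 1 := fun i => by omega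
    simp only [h2, Fin.card_filter_val_lt]
    exact min_eq_right (Nat.sub_le _ _)
  rw [← h1, card_eq_sum_card_fiberwise (t := univ)
    (f := fun i : Fin n => (diagramGraph σ).connectedComponentMk (.tw i)) (by simp)]
  refine sum_congr rfl fun c _ => ?_
  rw [compLength, Set.ncard_eq_toFinset_card', filter_filter]
  congr 1
  ext i
  simp

variable [NeZero n]

/-- The component of a bottom gap. -/
def gapComp (g : Fin (n + 1)) : Comp σ :=
  Fin.cases ((diagramGraph σ).connectedComponentMk (.bb 0))
    (fun i => (diagramGraph σ).connectedComponentMk (.bw i)) g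

theorem gapComp_succ (i : Fin n) :
    gapComp σ i.succ = (diagramGraph σ).connectedComponentMk (.bw i) := rfl

theorem gapComp_zero :
    gapComp σ 0 = (diagramGraph σ).connectedComponentMk (.bb 0) := rfl

theorem gapComp_castSucc (i : Fin n) :
    gapComp σ i.castSucc = (diagramGraph σ).connectedComponentMk (.bb i) := by
  rcases Nat.eq_zero_or_pos i.val with h | h
  · have h0 : i = 0 := Fin.ext (by simp [h])
    rw [h0, Fin.castSucc_zero', gapComp_zero]
  · have hj : i.castSucc = (⟨i.val - 1, by omega⟩ : Fin n).succ := by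
      ext; simp; omega
    rw [hj, gapComp_succ]
    exact mk_eq_of_link σ (.arc_bot _ _ (by simp; omega))

theorem mk_tb (k : Fin n) :
    (diagramGraph σ).connectedComponentMk (.tb k) =
      gapComp σ ((strandDown σ).symm k.castSucc) := by
  obtain ⟨i, rfl⟩ := σ.surjective k
  rw [strandDown_symm_castSucc, gapComp_succ]
  exact (mk_eq_of_link σ (.edge_wb i)).symm

theorem mk_tw (k : Fin n) :
    (diagramGraph σ).connectedComponentMk (.tw k) =
      gapComp σ ((strandDown σ).symm k.succ) := by
  by_cases h : k.val + 1 < n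
  · have hj : k.succ = (⟨k.val + 1, h⟩ : Fin n).castSucc := rfl
    rw [hj, ← mk_tb]
    exact mk_eq_of_link σ (.arc_top _ _ rfl)
  · have hj : k.succ = Fin.last n := by ext; simp; omega
    rw [hj, strandDown_symm_last, gapComp_zero]
    exact mk_eq_of_link σ (.mark _ _ (by omega) (by simp))

theorem mk_eq_gapComp_gap (a : Endpoint n) :
    (diagramGraph σ).connectedComponentMk a = gapComp σ (a.gap σ) := by
  cases a with
  | bb i => exact (gapComp_castSucc σ i).symm
  | bw i => rfl
  | tb i => exact mk_tb σ i
  | tw i => exact mk_tw σ i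

theorem gapComp_surjective : Function.Surjective (gapComp σ) := by
  intro c
  obtain ⟨a, rfl⟩ := c.exists_rep
  exact ⟨a.gap σ, (mk_eq_gapComp_gap σ a).symm⟩

theorem gapComp_gapPerm_last_eq_rankPath :
    gapComp σ (gapPerm σ (Fin.last n)) = rankPath σ := by
  rw [gapPerm_apply, strandUp_last, rankPath, mk_tb, Fin.castSucc_zero']

/-- The strands are followed from the first top gap back to the last bottom gap, since a
permutation cannot leave a set at a single point. -/
theorem gapComp_gapPerm (g : Fin (n + 1)) : gapComp σ (gapPerm σ g) = gapComp σ g := by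
  have key : ∀ i : Fin n, gapComp σ (gapPerm σ i.castSucc) = gapComp σ i.castSucc := by
    intro i
    rw [gapPerm_apply, strandUp_castSucc, ← mk_tw, gapComp_castSucc]
    exact (mk_eq_of_link σ (.edge_bw i)).symm
  induction g using Fin.lastCases with
  | cast i => exact key i
  | last =>
    by_contra hne
    -- The gaps in the component of the image of the last gap would form a stable set omitting the
    -- last gap, yet a stable set is its own image and so contains the preimage of each of its
    -- points.
    have himg := perm_image_eq_of_subset (gapPerm σ)
      {x | gapComp σ x = gapComp σ (gapPerm σ (Fin.last n))} (by
        intro x hx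
        induction x using Fin.lastCases with
        | cast i => exact (key i).trans hx
        | last => exact absurd hx.symm hne)
    have hmem : gapPerm σ (Fin.last n) ∈
        {x | gapComp σ x = gapComp σ (gapPerm σ (Fin.last n))} := rfl
    rw [← himg] at hmem
    obtain ⟨x, hx, hxl⟩ := hmem
    rw [(gapPerm σ).injective hxl] at hx
    exact hne hx.symm

theorem gapComp_last : gapComp σ (Fin.last n) = rankPath σ := by
  rw [← gapComp_gapPerm, gapComp_gapPerm_last_eq_rankPath]

theorem gap_of_gapComp_rep (g : Fin (n + 1)) :
    ∃ a : Endpoint n, a.gap σ = g ∧ (diagramGraph σ).connectedComponentMk a = gapComp σ g := by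
  induction g using Fin.lastCases with
  | cast i => exact ⟨.bb i, rfl, (gapComp_castSucc σ i).symm⟩
  | last =>
    obtain ⟨i, hi⟩ := Fin.exists_succ_eq.2 (Fin.last_pos' (n := n)).ne'
    exact ⟨.bw i, hi, by rw [← hi]; rfl⟩

/-- The open path counts as a cycle too, since `strandUp` closes it by sending the last bottom gap
to the first top gap. -/
theorem sameCycle_iff_gapComp_eq (g h : Fin (n + 1)) :
    (gapPerm σ).SameCycle g h ↔ gapComp σ g = gapComp σ h := by
  constructor
  · rintro ⟨k, rfl⟩
    have : ∀ x, gapComp σ ((gapPerm σ ^ k) x) = gapComp σ x := by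
      induction k using Int.induction_on with
      | zero => simp
      | succ k ih =>
        intro x
        rw [zpow_add_one, Equiv.Perm.mul_apply, ih, gapComp_gapPerm]
      | pred k ih =>
        intro x
        rw [zpow_sub_one, Equiv.Perm.mul_apply, ih, ← gapComp_gapPerm]
        simp
    exact (this g).symm
  · intro hgh
    obtain ⟨a, rfl, ha⟩ := gap_of_gapComp_rep σ g
    obtain ⟨b, rfl, hb⟩ := gap_of_gapComp_rep σ h
    exact sameCycle_gap_of_mk_eq σ (by rw [ha, hb, hgh])

/-- On a closed cycle, each top arc is followed by one strand going down on the right of an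
edge. -/
theorem compLength_eq_card {c : Comp σ} (hc : c ≠ rankPath σ) :
    compLength σ c = {i : Fin n | gapComp σ i.succ = c}.ncard := by
  have hnext : ∀ (i : Fin n) (h : i.val + 1 < n),
      (diagramGraph σ).connectedComponentMk (.tw i) = gapComp σ (σ.symm ⟨i.val + 1, h⟩).succ := by
    intro i h
    have hj : i.succ = (σ (σ.symm ⟨i.val + 1, h⟩)).castSucc := by
      rw [Equiv.apply_symm_apply]; rfl
    rw [mk_tw, hj, strandDown_symm_castSucc]
  refine Set.ncard_congr (fun i hi => σ.symm ⟨i.val + 1, hi.1⟩) ?_ ?_ ?_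
  · rintro i ⟨hi, rfl⟩
    exact (hnext i hi).symm
  · intro i j hi hj h
    have := congrArg Fin.val (σ.symm.injective h)
    exact Fin.ext (by simpa using this)
  · intro j hj
    -- The strand going down from the first top gap is preceded by no top arc, but it lies on the
    -- open path.
    have h0 : (σ j).val ≠ 0 := by
      intro h0
      apply hc
      have h1 : (0 : Fin n) = σ j := Fin.ext (by simp [h0])
      rw [← hj, rankPath, h1, mk_tb, strandDown_symm_castSucc]
    have hlt : (σ j).val - 1 + 1 < n := by omega
    have hback : σ.symm ⟨(σ j).val - 1 + 1, hlt⟩ = j := by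
      rw [Equiv.symm_apply_eq]
      exact Fin.ext (by simp; omega)
    refine ⟨⟨(σ j).val - 1, by omega⟩, ⟨hlt, ?_⟩, hback⟩
    rw [hnext _ hlt]
    exact (congrArg (fun x : Fin n => gapComp σ x.succ) hback).trans hj

theorem card_comp : Fintype.card (Comp σ) = numCycles σ + 1 := by
  classical
  have h := Set.ncard_add_ncard_compl {c : Comp σ | c ≠ rankPath σ}
  have h2 : {c : Comp σ | c ≠ rankPath σ}ᶜ = {rankPath σ} := by ext; simp
  rw [h2, Set.ncard_singleton, Nat.card_eq_fintype_card] at h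
  exact h.symm

theorem lengths_eq : rank σ ::ₘ cycleStructure σ =
    (univ : Finset (Comp σ)).val.map (compLength σ) := by
  classical
  have h : (univ : Finset (Comp σ)) =
      cons (rankPath σ) (Set.toFinite {c : Comp σ | c ≠ rankPath σ}).toFinset (by simp) := by
    ext c
    simp [em]
  rw [h, cons_val, Multiset.map_cons]
  rfl

theorem mem_lengths {x : ℕ} : x ∈ rank σ ::ₘ cycleStructure σ ↔ ∃ c, compLength σ c = x := by
  rw [lengths_eq]
  simp

/-- Modulo 2 the indicator of "`k` is even" is `k + 1`, and the sum over components is `(n - 1) + (ℓ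
+ 1)`. -/
theorem countP_even_lengths_mod_two :
    (((rank σ ::ₘ cycleStructure σ).countP (fun x => Even x) : ℕ) : ZMod 2) =
      n + numCycles σ := by
  classical
  have h1 : (rank σ ::ₘ cycleStructure σ).countP (fun x => Even x) =
      #{c : Comp σ | Even (compLength σ c)} := by
    rw [lengths_eq, Multiset.countP_map]
    rfl
  have h2 : ∀ k : ℕ, (if Even k then (1 : ZMod 2) else 0) = k + 1 := by
    intro k
    split_ifs with h
    · rw [(ZMod.natCast_eq_zero_iff_even).2 h, zero_add]
    · rw [(ZMod.natCast_eq_one_iff_odd).2 (Nat.not_even_iff_odd.1 h)]; rfl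
  rw [h1, card_filter, Nat.cast_sum]
  push_cast
  simp only [h2, sum_add_distrib]
  rw [← Nat.cast_sum, sum_compLength, sum_const, card_univ, card_comp]
  have : 1 ≤ n := NeZero.one_le
  push_cast [this]
  simp

end Gaps

end RauzyDyn

/-! ### The quadratic form and its radical -/

namespace RauzyDyn

open Finset Matrix

section Form

variable {n : ℕ} (σ : Equiv.Perm (Fin n))

/-- The incidence matrix of the non-crossing pairs `i < j`. -/
def ncMatrix : Matrix (Fin n) (Fin n) (ZMod 2) :=
  Matrix.of fun i j => if i < j ∧ σ i < σ j then 1 else 0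

/-- The quadratic form `|I| + χ(I)` over `ZMod 2`. -/
def quadForm (x : Fin n → ZMod 2) : ZMod 2 := ∑ i, x i + x ⬝ᵥ (ncMatrix σ *ᵥ x)

/-- The polar form of `quadForm`. -/
def polarForm : (Fin n → ZMod 2) →ₗ[ZMod 2] (Fin n → ZMod 2) →ₗ[ZMod 2] ZMod 2 :=
  LinearMap.mk₂ (ZMod 2) (fun x y => ((ncMatrix σ + (ncMatrix σ)ᵀ) *ᵥ x) ⬝ᵥ y)
    (fun x y z => by rw [mulVec_add, add_dotProduct])
    (fun c x y => by rw [mulVec_smul, smul_dotProduct])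
    (fun x y z => by rw [dotProduct_add])
    (fun c x y => by rw [dotProduct_smul])

theorem polarForm_apply (x y : Fin n → ZMod 2) :
    polarForm σ x y = x ⬝ᵥ (ncMatrix σ *ᵥ y) + y ⬝ᵥ (ncMatrix σ *ᵥ x) := by
  rw [polarForm, LinearMap.mk₂_apply, add_mulVec, add_dotProduct, mulVec_transpose,
    ← dotProduct_mulVec, dotProduct_comm, add_comm]

theorem polarForm_comm (x y : Fin n → ZMod 2) : polarForm σ x y = polarForm σ y x := by
  rw [polarForm_apply, polarForm_apply, add_comm]

theorem polarForm_self (x : Fin n → ZMod 2) : polarForm σ x x = 0 := by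
  rw [polarForm_apply, CharTwo.add_self_eq_zero]

theorem quadForm_add (x y : Fin n → ZMod 2) :
    quadForm σ (x + y) = quadForm σ x + quadForm σ y + polarForm σ x y := by
  rw [polarForm_apply]
  simp only [quadForm, mulVec_add, add_dotProduct, dotProduct_add, Pi.add_apply, sum_add_distrib]
  ring

theorem polarForm_eq_zero_iff (x : Fin n → ZMod 2) :
    polarForm σ x = 0 ↔ ∀ i, ((ncMatrix σ + (ncMatrix σ)ᵀ) *ᵥ x) i = 0 := by
  constructor
  · intro h i
    have := dotProduct_eq_zero _ fun y => LinearMap.congr_fun h y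
    exact congrFun this i
  · intro h
    ext y
    simp [polarForm, funext h]

theorem quadForm_indicator (I : Finset (Fin n)) :
    quadForm σ (fun i => if i ∈ I then 1 else 0) = (I.card + chi σ I : ℕ) := by
  rw [quadForm, chi, card_filter, sum_product]
  push_cast
  congr 1
  · simp
  · simp only [dotProduct, mulVec, ncMatrix, of_apply, mul_ite, mul_one, mul_zero, ite_mul,
      one_mul, zero_mul]
    simp [filter_and]

theorem arfBar_eq_sum_zsgn : arfBar σ = ∑ x : Fin n → ZMod 2, zsgn (quadForm σ x) := by
  refine Fintype.sum_bijective (fun (I : Finset (Fin n)) i => if i ∈ I then (1 : ZMod 2) else 0)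
    ⟨?_, ?_⟩ _ _ ?_
  · intro I J h
    ext i
    have := congrFun h i
    by_cases hI : i ∈ I <;> by_cases hJ : i ∈ J <;> simp_all
  · intro x
    refine ⟨univ.filter fun i => x i = 1, funext fun i => ?_⟩
    have : ∀ a : ZMod 2, (if a = 1 then (1 : ZMod 2) else 0) = a := by decide
    simpa using this (x i)
  · intro I
    rw [quadForm_indicator, zsgn_natCast]

/-- The sum of the entries of `x` at the bottom points on the right of a gap. -/
def suffixSum (x : Fin n → ZMod 2) (g : Fin (n + 1)) : ZMod 2 :=
  ∑ j, if g ≤ j.castSucc then x j else 0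

/-- The sum of the entries of `x` at the top points on the left of a gap. -/
def prefixSum (x : Fin n → ZMod 2) (g : Fin (n + 1)) : ZMod 2 :=
  ∑ j, if (σ j).castSucc < g then x j else 0

theorem suffixSum_last (x : Fin n → ZMod 2) : suffixSum x (Fin.last n) = 0 :=
  sum_eq_zero fun j _ => if_neg (not_le.2 (Fin.castSucc_lt_last j))

theorem suffixSum_zero (x : Fin n → ZMod 2) : suffixSum x 0 = ∑ j, x j :=
  sum_congr rfl fun _ _ => if_pos (Fin.zero_le _)

theorem suffixSum_castSucc (x : Fin n → ZMod 2) (i : Fin n) :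
    suffixSum x i.castSucc = x i + suffixSum x i.succ := by
  have h : x i = ∑ j, if i = j then x j else 0 := by simp
  rw [h, suffixSum, suffixSum, ← sum_add_distrib]
  refine sum_congr rfl fun j _ => ?_
  simp only [Fin.le_def, Fin.ext_iff, Fin.val_castSucc, Fin.val_succ]
  split_ifs <;> first | omega | simp

theorem prefixSum_zero (x : Fin n → ZMod 2) : prefixSum σ x 0 = 0 :=
  sum_eq_zero fun _ _ => if_neg (Fin.not_lt_zero _)

theorem prefixSum_last (x : Fin n → ZMod 2) : prefixSum σ x (Fin.last n) = ∑ j, x j :=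
  sum_congr rfl fun _ _ => if_pos (Fin.castSucc_lt_last _)

theorem prefixSum_succ (x : Fin n → ZMod 2) (i : Fin n) :
    prefixSum σ x (σ i).succ = x i + prefixSum σ x (σ i).castSucc := by
  have h : x i = ∑ j, if i = j then x j else 0 := by simp
  rw [h, prefixSum, prefixSum, ← sum_add_distrib]
  refine sum_congr rfl fun j _ => ?_
  have hσ : i = j ↔ (σ i).val = (σ j).val := by rw [← Fin.ext_iff, σ.injective.eq_iff]
  simp only [hσ, Fin.lt_def, Fin.val_castSucc, Fin.val_succ]
  split_ifs <;> first | omega | simp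

/-- An edge not crossing edge `i` is counted by exactly one of the two sums; a crossing edge is
counted by both or by neither. -/
theorem ncMatrix_symm_mulVec (x : Fin n → ZMod 2) (i : Fin n) :
    ((ncMatrix σ + (ncMatrix σ)ᵀ) *ᵥ x) i =
      prefixSum σ x (σ i).castSucc + suffixSum x i.succ := by
  rw [mulVec, dotProduct, prefixSum, suffixSum, ← sum_add_distrib]
  refine sum_congr rfl fun j _ => ?_
  have hσ : i.val = j.val ↔ (σ i).val = (σ j).val := by
    rw [← Fin.ext_iff, ← Fin.ext_iff, σ.injective.eq_iff]
  simp only [ncMatrix, Matrix.add_apply, transpose_apply, of_apply, Fin.lt_def, Fin.le_def,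
    Fin.val_castSucc, Fin.val_succ]
  split_ifs <;> first | omega | simp [CharTwo.add_self_eq_zero]

/-- The added condition at gap `0` is automatic: both sides are the total sum there. -/
theorem polarForm_eq_zero_iff_suffixSum (x : Fin n → ZMod 2) :
    polarForm σ x = 0 ↔ ∀ g, prefixSum σ x (strandDown σ g) = suffixSum x g := by
  simp only [polarForm_eq_zero_iff, ncMatrix_symm_mulVec, CharTwo.add_eq_zero]
  constructor
  · intro h g
    induction g using Fin.cases with
    | zero => rw [strandDown_zero, prefixSum_last, suffixSum_zero]
    | succ i => rw [strandDown_succ, h]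
  · intro h i
    rw [← strandDown_succ, h]

theorem suffixSum_eq {x : Fin n → ZMod 2} {F : Fin (n + 1) → ZMod 2} (h0 : F (Fin.last n) = 0)
    (hF : ∀ i : Fin n, x i = F i.castSucc + F i.succ) (g : Fin (n + 1)) :
    suffixSum x g = F g := by
  induction g using Fin.reverseInduction with
  | last => rw [suffixSum_last, h0]
  | cast i ih =>
    rw [suffixSum_castSucc, ih, hF, add_assoc, CharTwo.add_self_eq_zero, add_zero]

theorem prefixSum_eq {x : Fin n → ZMod 2} {F : Fin (n + 1) → ZMod 2} (h0 : F 0 = 0)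
    (hF : ∀ i : Fin n, x i = F (σ i).succ + F (σ i).castSucc) (g : Fin (n + 1)) :
    prefixSum σ x g = F g := by
  induction g using Fin.induction with
  | zero => rw [prefixSum_zero, h0]
  | succ k ih =>
    obtain ⟨i, rfl⟩ := σ.surjective k
    rw [prefixSum_succ, ih, hF, add_assoc, CharTwo.add_self_eq_zero, add_zero]

variable [NeZero n]

/-- The vector of the jumps of a function on the components across the edges. -/
def jumpVec (f : Comp σ → ZMod 2) (i : Fin n) : ZMod 2 :=
  f (gapComp σ i.castSucc) + f (gapComp σ i.succ)

theorem suffixSum_jumpVec {f : Comp σ → ZMod 2} (hf : f (rankPath σ) = 0) (g : Fin (n + 1)) :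
    suffixSum (jumpVec σ f) g = f (gapComp σ g) :=
  suffixSum_eq (F := fun g => f (gapComp σ g)) (by rw [gapComp_last, hf]) (fun _ => rfl) g

/-- Prefix and suffix sums both telescope to `f`. The vanishing of `f` on the open path serves both
normalisations, as that path contains the first top gap and the last bottom gap. -/
theorem polarForm_jumpVec {f : Comp σ → ZMod 2} (hf : f (rankPath σ) = 0) :
    polarForm σ (jumpVec σ f) = 0 := by
  rw [polarForm_eq_zero_iff_suffixSum]
  intro g
  have hup : ∀ i : Fin n, gapComp σ ((strandDown σ).symm (σ i).succ) = gapComp σ i.castSucc := by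
    intro i
    rw [← strandUp_castSucc, ← gapPerm_apply, gapComp_gapPerm]
  rw [suffixSum_jumpVec σ hf,
    prefixSum_eq σ (F := fun k => f (gapComp σ ((strandDown σ).symm k))), Equiv.symm_apply_apply]
  · rw [← hf, ← gapComp_gapPerm_last_eq_rankPath, gapPerm_apply, strandUp_last]
  · intro i
    rw [hup, strandDown_symm_castSucc]; rfl

theorem exists_jumpVec_eq {x : Fin n → ZMod 2} (hx : polarForm σ x = 0) :
    ∃ f : Comp σ → ZMod 2, f (rankPath σ) = 0 ∧ jumpVec σ f = x := by
  rw [polarForm_eq_zero_iff_suffixSum] at hx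
  -- The suffix sum is thus constant on cycles of `gapPerm` and descends to the desired function on
  -- components.
  have hπ : ∀ g, suffixSum x (gapPerm σ g) = suffixSum x g := by
    intro g
    rw [← hx, strandDown_gapPerm]
    induction g using Fin.lastCases with
    | last => rw [strandUp_last, prefixSum_zero, suffixSum_last]
    | cast i =>
      rw [strandUp_castSucc, prefixSum_succ, suffixSum_castSucc, ← strandDown_succ, hx]
  have hsame : ∀ g h, gapComp σ g = gapComp σ h → suffixSum x g = suffixSum x h := by
    intro g h hgh
    obtain ⟨k, hk⟩ := ((sameCycle_iff_gapComp_eq σ g h).2 hgh).exists_nat_pow_eq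
    rw [← hk]
    clear hk hgh
    induction k with
    | zero => rfl
    | succ k ih => rw [pow_succ', Equiv.Perm.mul_apply, hπ, ih]
  have hcomp : ∀ g, suffixSum x (Function.surjInv (gapComp_surjective σ) (gapComp σ g)) =
      suffixSum x g := fun g => hsame _ _ (Function.surjInv_eq _ _)
  refine ⟨fun c => suffixSum x (Function.surjInv (gapComp_surjective σ) c), ?_, ?_⟩
  · rw [← gapComp_last]
    exact (hcomp _).trans (suffixSum_last x)
  · funext i
    rw [jumpVec, hcomp, hcomp, suffixSum_castSucc, add_assoc, CharTwo.add_self_eq_zero, add_zero]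

/-- The radical is parametrised by arbitrary functions on the closed cycles, extended by `0` to the
open path; suffix sums recover the function. -/
theorem card_ker_polarForm : Nat.card (LinearMap.ker (polarForm σ)) = 2 ^ numCycles σ := by
  classical
  let ext0 : ({c : Comp σ // c ≠ rankPath σ} → ZMod 2) → Comp σ → ZMod 2 :=
    fun f c => if h : c ≠ rankPath σ then f ⟨c, h⟩ else 0
  have hext : ∀ f, ext0 f (rankPath σ) = 0 := fun f => dif_neg (by simp)
  let Φ : ({c : Comp σ // c ≠ rankPath σ} → ZMod 2) → LinearMap.ker (polarForm σ) :=
    fun f => ⟨jumpVec σ (ext0 f), polarForm_jumpVec σ (hext f)⟩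
  have hΦ : Function.Bijective Φ := by
    constructor
    · intro f f' h
      have h' : jumpVec σ (ext0 f) = jumpVec σ (ext0 f') := congrArg Subtype.val h
      funext ⟨c, hc⟩
      obtain ⟨g, rfl⟩ := gapComp_surjective σ c
      have := suffixSum_jumpVec σ (hext f) g
      rw [h', suffixSum_jumpVec σ (hext f')] at this
      simpa [ext0, hc] using this.symm
    · rintro ⟨x, hx⟩
      obtain ⟨f, hf, rfl⟩ := exists_jumpVec_eq σ hx
      refine ⟨fun c => f c, Subtype.ext (congrArg (jumpVec σ) (funext fun c => ?_))⟩
      by_cases hc : c = rankPath σ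
      · rw [hc]
        simp [ext0, hf]
      · simp [ext0, hc]
  rw [← Nat.card_congr (Equiv.ofBijective Φ hΦ), Nat.card_fun, Nat.card_zmod]
  rfl

open scoped Classical in
/-- The radical vector of a cycle. -/
noncomputable def cycleVec (c : Comp σ) : Fin n → ZMod 2 :=
  jumpVec σ (fun d => if d = c then 1 else 0)

theorem polarForm_cycleVec {c : Comp σ} (hc : c ≠ rankPath σ) : polarForm σ (cycleVec σ c) = 0 :=
  polarForm_jumpVec σ (if_neg hc.symm)

/-- The cycle vectors span the radical, on which `quadForm` is additive. -/
theorem quadForm_radical_iff :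
    (∀ x, polarForm σ x = 0 → quadForm σ x = 0) ↔
      ∀ c, c ≠ rankPath σ → quadForm σ (cycleVec σ c) = 0 := by
  classical
  refine ⟨fun h c hc => h _ (polarForm_cycleVec σ hc), fun h x hx => ?_⟩
  obtain ⟨f, hf, rfl⟩ := exists_jumpVec_eq σ hx
  have key : ∀ s : Finset (Comp σ), (∀ c ∈ s, c ≠ rankPath σ) →
      quadForm σ (∑ c ∈ s, cycleVec σ c) = 0 := by
    intro s
    induction s using Finset.induction_on with
    | empty => intro _; simp [quadForm]
    | insert c s hcs ih =>
      intro hs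
      have hc := hs c (mem_insert_self c s)
      rw [sum_insert hcs, quadForm_add, h c hc, polarForm_cycleVec σ hc,
        ih fun d hd => hs d (mem_insert_of_mem hd)]
      simp
  have hsum : jumpVec σ f = ∑ c ∈ univ.filter (fun c => f c = 1), cycleVec σ c := by
    have h1 : ∀ a : ZMod 2, (if a = 1 then (1 : ZMod 2) else 0) = a := by decide
    funext i
    simp only [Finset.sum_apply, cycleVec, jumpVec, sum_add_distrib, sum_ite_eq, mem_filter, mem_univ,
      true_and, h1]
  rw [hsum]
  refine key _ fun c hc hcr => ?_
  rw [mem_filter, hcr, hf] at hc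
  exact zero_ne_one hc.2

end Form

end RauzyDyn

/-! ### The value of the form on a cycle vector -/

namespace RauzyDyn

open Finset Matrix

/-- The sign of `π` compares the inversions of `a` with those of `a ∘ π`. -/
theorem prod_sign_sub_mul_sign_sub {m : ℕ} (π : Equiv.Perm (Fin m)) {a b : Fin m → ℤ}
    (hab : ∀ i, a (π i) = b i) (ha : Function.Injective a) :
    ∏ j, ∏ i ∈ Iio j, (a i - a j).sign * (b i - b j).sign = Equiv.Perm.sign π := by
  have h := Equiv.Perm.prod_Iio_comp_eq_sign_mul_prod π (f := fun i j => (a i - a j).sign)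
    (fun i j => by rw [← Int.sign_neg, neg_sub])
  simp only [hab] at h
  simp only [prod_mul_distrib]
  rw [h, mul_left_comm]
  simp only [← prod_mul_distrib]
  rw [prod_eq_one, mul_one, Int.cast_id]
  intro j _
  refine prod_eq_one fun i hi => ?_
  have hij : a i - a j ≠ 0 := sub_ne_zero.2 (ha.ne (mem_Iio.1 hi).ne)
  rcases lt_or_gt_of_ne hij with h | h
  · simp [Int.sign_eq_neg_one_of_neg h]
  · simp [Int.sign_eq_one_of_pos h]

theorem prod_prod_Iio_eq {m : ℕ} (F : Fin m → Fin m → ℤ) :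
    ∏ j, ∏ i ∈ Iio j, F i j = ∏ j, ∏ i, if i < j then F i j else 1 := by
  refine prod_congr rfl fun j _ => ?_
  rw [← prod_filter]
  congr 1
  ext i
  simp

theorem zsgn_dotProduct_ncMatrix {n : ℕ} (σ : Equiv.Perm (Fin n)) (P : Fin n → Prop) [DecidablePred P] :
    zsgn ((fun i => if P i then 1 else 0) ⬝ᵥ (ncMatrix σ *ᵥ fun i => if P i then 1 else 0)) =
      ∏ j, ∏ i, if i < j then (if P i ∧ P j then ((σ i : ℤ) - σ j).sign else 1) else 1 := by
  rw [dotProduct, zsgn_sum, prod_comm]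
  refine prod_congr rfl fun i _ => ?_
  rw [mulVec, dotProduct, mul_sum, zsgn_sum]
  refine prod_congr rfl fun j _ => ?_
  simp only [ncMatrix, of_apply]
  by_cases hij : i < j
  · have hne : (σ i).val ≠ (σ j).val := fun h => hij.ne (σ.injective (Fin.ext h))
    by_cases hi : P i <;> by_cases hj : P j <;> by_cases hs : σ i < σ j
    · have : (σ i).val < (σ j).val := hs
      rw [Int.sign_eq_neg_one_of_neg (by omega)]
      simp [hij, hi, hj, hs, zsgn_one]
    · have : ¬ (σ i).val < (σ j).val := hs
      rw [Int.sign_eq_one_of_pos (by omega)]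
      simp [hij, hi, hj, hs, zsgn_zero]
    all_goals simp [hi, hj, zsgn_zero]
  · simp [hij, zsgn_zero]

section Cycle

variable {n : ℕ} [NeZero n] (σ : Equiv.Perm (Fin n))

open scoped Classical in
theorem sign_cycleOf_gapPerm (g : Fin (n + 1)) :
    (Equiv.Perm.sign ((gapPerm σ).cycleOf g) : ℤ) =
      (-1) ^ (#{h | gapComp σ h = gapComp σ g} + 1) := by
  by_cases hg : gapPerm σ g = g
  · have h1 : ({h | gapComp σ h = gapComp σ g} : Finset (Fin (n + 1))) = {g} := by
      ext h
      rw [mem_filter, mem_singleton, eq_comm, ← sameCycle_iff_gapComp_eq]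
      simp only [mem_univ, true_and]
      exact ⟨fun hs => (hs.eq_of_left hg).symm, fun hs => hs ▸ Equiv.Perm.SameCycle.refl _ _⟩
    rw [(Equiv.Perm.cycleOf_eq_one_iff _).2 hg, h1]
    simp
  · have h1 : ({h | gapComp σ h = gapComp σ g} : Finset (Fin (n + 1))) =
        ((gapPerm σ).cycleOf g).support := by
      ext h
      rw [mem_filter, Equiv.Perm.mem_support_cycleOf_iff, sameCycle_iff_gapComp_eq,
        Equiv.Perm.mem_support]
      simp [hg, eq_comm]
    rw [(Equiv.Perm.isCycle_cycleOf _ hg).sign, h1, pow_succ]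
    simp

-- On the gaps of `c`, `strandUp` is `strandDown` after `gapPerm`, so comparing their inversions
-- gives the sign of one cycle.
open scoped Classical in
theorem prod_sign_strands (c : Comp σ) :
    (∏ h, ∏ g ∈ Iio h, if gapComp σ g = c ∧ gapComp σ h = c then
        ((strandDown σ g : ℤ) - strandDown σ h).sign else 1) *
      (∏ h, ∏ g ∈ Iio h, if gapComp σ g = c ∧ gapComp σ h = c then
        ((strandUp σ g : ℤ) - strandUp σ h).sign else 1) =
      (-1) ^ (#{g | gapComp σ g = c} + 1) := by
  obtain ⟨g₀, rfl⟩ := gapComp_surjective σ c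
  set c := gapComp σ g₀
  -- Outside `c` the keys do not depend on `w` and exceed all keys on `c`, so pairs not contained in
  -- `c` contribute equal signs, which cancel.
  let key (w : Equiv.Perm (Fin (n + 1))) (g : Fin (n + 1)) : ℤ :=
    if gapComp σ g = c then (w g : ℤ) else n + 1 + g
  have hkey : ∀ g, key (strandDown σ) ((gapPerm σ).cycleOf g₀ g) = key (strandUp σ) g := by
    intro g
    simp only [key, Equiv.Perm.cycleOf_apply, sameCycle_iff_gapComp_eq]
    by_cases hg : gapComp σ g = c
    · rw [if_pos hg.symm, gapComp_gapPerm, if_pos hg, if_pos hg, strandDown_gapPerm]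
    · rw [if_neg (Ne.symm hg), if_neg hg, if_neg hg]
  have hinj : Function.Injective (key (strandDown σ)) := by
    intro g h hgh
    have h1 := (strandDown σ g).isLt
    have h2 := (strandDown σ h).isLt
    simp only [key] at hgh
    split_ifs at hgh
    · exact (strandDown σ).injective (Fin.ext (by omega))
    · omega
    · omega
    · exact Fin.ext (by omega)
  rw [← sign_cycleOf_gapPerm, ← prod_sign_sub_mul_sign_sub _ hkey hinj, ← prod_mul_distrib]
  refine prod_congr rfl fun h _ => ?_
  rw [← prod_mul_distrib]
  refine prod_congr rfl fun g hgh => ?_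
  have hgh' : g < h := mem_Iio.1 hgh
  have hlt : g.val < h.val := hgh'
  have b1 := (strandDown σ g).isLt
  have b2 := (strandDown σ h).isLt
  have b3 := (strandUp σ g).isLt
  have b4 := (strandUp σ h).isLt
  simp only [key]
  by_cases hg : gapComp σ g = c <;> by_cases hh : gapComp σ h = c
  · simp [hg, hh]
  · simp only [hg, hh, and_false, if_true, if_false]
    rw [Int.sign_eq_neg_one_of_neg (by omega), Int.sign_eq_neg_one_of_neg (by omega)]
    rfl
  · simp only [hg, hh, false_and, if_true, if_false]
    rw [Int.sign_eq_one_of_pos (by omega), Int.sign_eq_one_of_pos (by omega)]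
  · simp only [hg, hh, and_false, if_false]
    rw [Int.sign_eq_neg_one_of_neg (by omega)]
    rfl

open scoped Classical in
theorem prod_sign_strandUp {c : Comp σ} (hc : c ≠ rankPath σ) :
    (∏ h, ∏ g ∈ Iio h, if gapComp σ g = c ∧ gapComp σ h = c then
        ((strandUp σ g : ℤ) - strandUp σ h).sign else 1) =
      zsgn ((fun i : Fin n => if gapComp σ i.castSucc = c then 1 else 0) ⬝ᵥ
        (ncMatrix σ *ᵥ fun i => if gapComp σ i.castSucc = c then 1 else 0)) := by
  have hl : gapComp σ (Fin.last n) ≠ c := by rw [gapComp_last]; exact hc.symm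
  rw [zsgn_dotProduct_ncMatrix, prod_prod_Iio_eq, Fin.prod_univ_castSucc]
  simp only [Fin.prod_univ_castSucc (n := n), hl, strandUp_castSucc, Fin.castSucc_lt_castSucc_iff]
  simp

-- Gap `0` goes to the last top gap, above all others, so its pairs contribute `+1` even when it
-- lies on `c`.
open scoped Classical in
theorem prod_sign_strandDown (c : Comp σ) :
    (∏ h, ∏ g ∈ Iio h, if gapComp σ g = c ∧ gapComp σ h = c then
        ((strandDown σ g : ℤ) - strandDown σ h).sign else 1) =
      zsgn ((fun i : Fin n => if gapComp σ i.succ = c then 1 else 0) ⬝ᵥ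
        (ncMatrix σ *ᵥ fun i => if gapComp σ i.succ = c then 1 else 0)) := by
  have h0 : ∀ i : Fin n, ((n : ℤ) - (σ i : ℤ)).sign = 1 := fun i =>
    Int.sign_eq_one_of_pos (by have := (σ i).isLt; omega)
  rw [zsgn_dotProduct_ncMatrix, prod_prod_Iio_eq, Fin.prod_univ_succ]
  simp only [Fin.prod_univ_succ (n := n), strandDown_succ, strandDown_zero,
    Fin.succ_lt_succ_iff]
  simp [h0]

/-- Split the vector as `U + D`, the edges whose left, respectively right, strand lies on `c`. Their
sizes are the number of gaps of `c` and its length. The non-crossing terms together have the parity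
of the number of gaps plus one, so the gap counts cancel. -/
theorem quadForm_cycleVec {c : Comp σ} (hc : c ≠ rankPath σ) :
    quadForm σ (cycleVec σ c) = compLength σ c + 1 := by
  classical
  set U : Fin n → ZMod 2 := fun i => if gapComp σ i.castSucc = c then 1 else 0 with hU
  set D : Fin n → ZMod 2 := fun i => if gapComp σ i.succ = c then 1 else 0 with hD
  have hUD : cycleVec σ c = U + D := by
    funext i
    simp only [cycleVec, jumpVec, hU, hD, Pi.add_apply]
  -- Pair the radical vector `U + D` with `U`; the form is alternating.
  have hB : polarForm σ U D = 0 := by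
    have h := LinearMap.congr_fun (polarForm_cycleVec σ hc) U
    rwa [hUD, polarForm_comm, map_add, polarForm_self, zero_add] at h
  have hsumU : ∑ i, U i = (#{g | gapComp σ g = c} : ℕ) := by
    have hl : gapComp σ (Fin.last n) ≠ c := by rw [gapComp_last]; exact hc.symm
    rw [card_filter, Fin.sum_univ_castSucc, if_neg hl]
    simp [hU]
  have hsumD : ∑ i, D i = compLength σ c := by
    rw [compLength_eq_card σ hc, Set.ncard_eq_toFinset_card']
    simp [hD]
  have hprod := prod_sign_strands σ c
  rw [prod_sign_strandUp σ hc, prod_sign_strandDown, ← hU, ← hD] at hprod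
  apply zsgn_injective
  rw [hUD, quadForm_add, hB, add_zero, quadForm, quadForm, hsumU, hsumD]
  simp only [zsgn_add, zsgn_natCast, zsgn_one]
  calc _ = (-1) ^ #{g | gapComp σ g = c} * (-1) ^ compLength σ c *
        (zsgn (D ⬝ᵥ (ncMatrix σ *ᵥ D)) * zsgn (U ⬝ᵥ (ncMatrix σ *ᵥ U))) := by ring
    _ = ((-1) ^ #{g | gapComp σ g = c}) ^ 2 * (-1) ^ compLength σ c * (-1) := by
        rw [hprod]; ring
    _ = _ := by rw [← pow_mul, mul_comm _ 2, pow_mul]; simp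

end Cycle

/-! ### Parity of `n + ℓ` and the square of `Ā` -/

section Main

variable {n : ℕ} [NeZero n] (σ : Equiv.Perm (Fin n))

theorem even_add_numCycles : Even (n + numCycles σ) := by
  have h := isSquare_card_mul_card_ker (quadForm σ) (polarForm σ) (quadForm_add σ)
  rw [card_ker_polarForm, Fintype.card_fun, ZMod.card, Fintype.card_fin] at h
  have h2 : IsSquare (2 ^ (n + numCycles σ) : ℕ) := by
    rw [← Int.isSquare_natCast_iff]
    push_cast at h ⊢
    rwa [pow_add]
  obtain ⟨r, hr⟩ := h2
  obtain ⟨k, -, rfl⟩ := (Nat.dvd_prime_pow Nat.prime_two).1 (Dvd.intro r hr.symm)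
  rw [← pow_add] at hr
  exact ⟨k, Nat.pow_right_injective le_rfl hr⟩

theorem even_countP_even_lengths :
    Even ((rank σ ::ₘ cycleStructure σ).countP (fun x => Even x)) := by
  rw [← ZMod.natCast_eq_zero_iff_even, countP_even_lengths_mod_two]
  exact_mod_cast ZMod.natCast_eq_zero_iff_even.2 (even_add_numCycles σ)

/-- As the number of even lengths is even, it vanishes when all cycles have odd length. -/
theorem forall_odd_compLength_iff :
    (∀ c, c ≠ rankPath σ → Odd (compLength σ c)) ↔
      ∀ x ∈ rank σ ::ₘ cycleStructure σ, ¬ Even x := by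
  classical
  constructor
  · intro h
    have hc : ∀ x ∈ cycleStructure σ, ¬ Even x := by
      intro x hx
      obtain ⟨c, hc, rfl⟩ := Multiset.mem_map.1 hx
      exact Nat.not_even_iff_odd.2 (h c (by simpa using hc))
    have heven := even_countP_even_lengths σ
    intro x hx
    rcases Multiset.mem_cons.1 hx with rfl | hx
    · intro hr
      rw [Multiset.countP_cons_of_pos _ hr, Multiset.countP_eq_zero.2 hc] at heven
      exact absurd heven (by decide)
    · exact hc x hx
  · intro h c _
    exact Nat.not_even_iff_odd.1 (h _ ((mem_lengths σ).2 ⟨c, rfl⟩))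

open scoped Classical in
theorem arfBar_sq : arfBar σ ^ 2 =
    if ∀ x ∈ rank σ ::ₘ cycleStructure σ, ¬ Even x then 2 ^ (n + numCycles σ) else 0 := by
  have hiff : (∀ x, polarForm σ x = 0 → quadForm σ x = 0) ↔
      ∀ x ∈ rank σ ::ₘ cycleStructure σ, ¬ Even x := by
    rw [← forall_odd_compLength_iff, quadForm_radical_iff]
    refine forall₂_congr fun c hc => ?_
    rw [quadForm_cycleVec σ hc, ← ZMod.natCast_eq_one_iff_odd, CharTwo.add_eq_zero]
  rw [arfBar_eq_sum_zsgn, sq_sum_zsgn _ _ (quadForm_add σ), card_ker_polarForm]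
  simp only [hiff]
  simp [pow_add]

end Main

end RauzyDyn

theorem mainTheorem7 (n : ℕ) [NeZero n]
    (C : Set (RauzyDyn.IrredPerm n)) (hC : RauzyDyn.IsRauzyClass C)
    (σ : RauzyDyn.IrredPerm n) (hσ : σ ∈ C) :
    Even ((RauzyDyn.rank σ.1 ::ₘ RauzyDyn.cycleStructure σ.1).countP (fun x => Even x)) ∧
    (RauzyDyn.sgn σ.1 : ℝ) =
      (2 : ℝ) ^ (-(((n : ℝ) + (RauzyDyn.numCycles σ.1 : ℝ)) / 2)) * (RauzyDyn.arfBar σ.1 : ℝ) ∧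
    (RauzyDyn.sgn σ.1 = 0 ↔
      ∃ x ∈ RauzyDyn.rank σ.1 ::ₘ RauzyDyn.cycleStructure σ.1, Even x) := by
  have hsq := RauzyDyn.arfBar_sq σ.1
  refine ⟨RauzyDyn.even_countP_even_lengths σ.1, ?_, ?_⟩
  · by_cases h0 : RauzyDyn.arfBar σ.1 = 0
    · simp [RauzyDyn.sgn, h0]
    · rw [if_pos (by
        by_contra hn
        rw [if_neg hn] at hsq
        exact h0 (pow_eq_zero_iff two_ne_zero |>.1 hsq))] at hsq
      obtain ⟨k, hk⟩ := RauzyDyn.even_add_numCycles σ.1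
      have hk' : ((n : ℝ) + (RauzyDyn.numCycles σ.1 : ℝ)) / 2 = k := by
        have : (n : ℝ) + (RauzyDyn.numCycles σ.1 : ℝ) = k + k := by exact_mod_cast hk
        linarith
      have habs : |RauzyDyn.arfBar σ.1| = 2 ^ k := by
        rw [← abs_of_pos (show (0 : ℤ) < 2 ^ k by positivity), ← sq_eq_sq_iff_abs_eq_abs, hsq, hk]
        ring
      rw [hk', Real.rpow_neg two_pos.le, Real.rpow_natCast, RauzyDyn.sgn]
      have hmul := Int.sign_mul_abs (RauzyDyn.arfBar σ.1)
      rw [habs] at hmul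
      rw [eq_inv_mul_iff_mul_eq₀ (by positivity), mul_comm]
      exact_mod_cast hmul
  · rw [RauzyDyn.sgn, Int.sign_eq_zero_iff_zero, ← pow_eq_zero_iff (two_ne_zero (α := ℕ)), hsq,
      ite_eq_right_iff]
    have hne : (2 : ℤ) ^ (n + RauzyDyn.numCycles σ.1) ≠ 0 := by positivity
    simp only [hne, imp_false, not_forall, not_not, exists_prop]
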